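/- All systems are finite-dimensional and $\log$ is the natural logarithm. A state is a positive semidefinite operator of unit trace; a quantum channel is a linear, completely positive, trace-preserving map; a subnormalized positive operator is a positive semidefinite operator of trace at most $1$. Let $\alpha>1$. A quantum Rényi divergence of order $\alpha$ is a quantity $\mathbb{D}_\alpha(\rho\|\sigma)\in(-\infty,+\infty]$, defined for subnormalized positive operators $\rho\neq 0$ and $\sigma$ on a common (arbitrary) system, such that, with $Q_\alpha:=\exp((\alpha-1)\mathbb{D}_\alpha)$: (1) $\mathbb{D}_\alpha(\rho\|\sigma)$ is jointly continuous on the set of pairs with $\rho\neq0$ and $\sigma$ positive definite; (2) $\mathbb{D}_\alpha(U\rho U^\dagger\|U\sigma U^\dagger)=\mathbb{D}_\alpha(\rho\|\sigma)$ for all unitaries $U$; (3) $\mathbb{D}_\alpha(1\|\tfrac12)=\log 2$ on the one-dimensional system; (4) $\rho\ge\sigma$ implies $\mathbb{D}_\alpha(\rho\|\sigma)\ge0$, and $\rho\le\sigma$ implies $\mathbb{D}_\alpha(\rho\|\sigma)\le0$; (5) $\mathbb{D}_\alpha(\rho\otimes\tau\|\sigma\otimes\omega)=\mathbb{D}_\alpha(\rho\|\sigma)+\mathbb{D}_\alpha(\tau\|\omega)$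 for $\rho,\tau\neq0$; (6) $Q_\alpha(\rho\oplus\tau\|\sigma\oplus\omega)=\frac{\operatorname{Tr}\rho}{\operatorname{Tr}\rho+\operatorname{Tr}\tau}Q_\alpha(\rho\|\sigma)+\frac{\operatorname{Tr}\tau}{\operatorname{Tr}\rho+\operatorname{Tr}\tau}Q_\alpha(\tau\|\omega)$ for $\rho,\tau\neq0$ with $\rho\oplus\tau$ and $\sigma\oplus\omega$ subnormalized; (7) for states $\rho,\sigma$: $\mathbb{D}_\alpha(\rho\|\sigma)\ge0$, with equality if and only if $\rho=\sigma$; (8) $\mathbb{D}_\alpha(\mathcal N(\rho)\|\mathcal N(\sigma))\le\mathbb{D}_\alpha(\rho\|\sigma)$ for every quantum channel $\mathcal N$; (9) $Q_\alpha$ is either jointly convex or jointly concave on pairs of states; (10) $\sigma\le\sigma'$ implies $\mathbb{D}_\alpha(\rho\|\sigma)\ge\mathbb{D}_\alpha(\rho\|\sigma')$. Let $\mathcal D$ be a set of quantum states with a neighbouring relation $\sim$. A quantum channel $\mathcal A$ is $(\epsilon,\alpha)$-Rényi differentially private (with respect to $\mathbb{D}_\alpha$) if $$\sup_{\rho,\sigma\in\mathcal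 D,\ \rho\sim\sigma}\mathbb{D}_\alpha(\mathcal A(\rho)\|\mathcal A(\sigma))\le\epsilon,$$ and $(\epsilon,\delta)$-differentially private if $\operatorname{Tr}(M\mathcal A(\rho))\le e^{\epsilon}\operatorname{Tr}(M\mathcal A(\sigma))+\delta$ for all operators $0\le M\le\mathbb 1$ and all $\rho,\sigma\in\mathcal D$ with $\rho\sim\sigma$. **Lemma.** Let $\alpha>1$, let $\mathbb{D}_\alpha$ be a quantum Rényi divergence of order $\alpha$, let $\epsilon\in\mathbb R$ and $0<\delta\le1$. If a quantum channel $\mathcal A$ is $(\epsilon,\alpha)$-Rényi differentially private, then it is $\left(\epsilon+\frac{g(\delta)}{\alpha-1},\ \delta\right)$-differentially private, where $g(\delta)=-\log\left(1-\sqrt{1-\delta^2}\right)$. -/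

import Mathlib

open scoped Kronecker ComplexOrder

noncomputable section

namespace QDP

/-- A quantum state on the finite-dimensional system `ℂⁿ`: a positive semidefinite operator with
unit trace. -/
def IsState {n : Type*} [Fintype n] (ρ : Matrix n n ℂ) : Prop :=
  ρ.PosSemidef ∧ ρ.trace = 1

/-- A subnormalized positive operator: positive semidefinite with trace at most one. -/
def IsSub {n : Type*} [Fintype n] (ρ : Matrix n n ℂ) : Prop :=
  ρ.PosSemidef ∧ ρ.trace.re ≤ 1

/-- The action of `Φ ⊗ id` on `L(ℂᵐ ⊗ ℂᵏ)`: the map `Φ` is applied to every `m × m` block. -/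
def ampliation {m n : Type*} (Φ : Matrix m m ℂ →ₗ[ℂ] Matrix n n ℂ) (k : ℕ)
    (X : Matrix (m × Fin k) (m × Fin k) ℂ) : Matrix (n × Fin k) (n × Fin k) ℂ :=
  Matrix.of fun p q => Φ (Matrix.of fun i j => X (i, p.2) (j, q.2)) p.1 q.1

/-- A quantum channel: a linear, completely positive, trace-preserving map. -/
structure IsChannel {m n : Type*} [Fintype m] [Fintype n]
    (Φ : Matrix m m ℂ →ₗ[ℂ] Matrix n n ℂ) : Prop where
  completelyPositive : ∀ (k : ℕ) (X : Matrix (m × Fin k) (m × Fin k) ℂ),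
    X.PosSemidef → (ampliation Φ k X).PosSemidef
  tracePreserving : ∀ X : Matrix m m ℂ, (Φ X).trace = X.trace

/-- Direct sum `ρ ⊕ τ` of operators. -/
def directSum {m n : Type*} (ρ : Matrix m m ℂ) (τ : Matrix n n ℂ) : Matrix (m ⊕ n) (m ⊕ n) ℂ :=
  Matrix.fromBlocks ρ 0 0 τ

/-- A quantity `𝔻(ρ‖σ)`, given on all finite-dimensional systems, with extended real values.
Only its values at subnormalized positive operators `ρ ≠ 0` and `σ` matter. -/
abbrev DivergenceQuantity : Type 1 :=
  ∀ ⦃n : Type⦄ [Fintype n], Matrix n n ℂ → Matrix n n ℂ → EReal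

/-- `Q = g_α(𝔻)` with the strictly monotonic function `g_α(t) = exp((α - 1) t)`, with values in
`[0, ∞]`. -/
def Qfun (α : ℝ) (D : DivergenceQuantity) {n : Type} [Fintype n] (ρ σ : Matrix n n ℂ) : ENNReal :=
  EReal.exp (((α - 1 : ℝ) : EReal) * D ρ σ)

/-- Quantum Rényi divergences of order `α`, by their defining list of properties. The order is the
parameter of the exponential `g_α(t) = exp((α - 1) t)` in the general mean property: on commuting
operators, it is the order of the classical Rényi relative entropy that `D` reduces to. -/
structure IsQuantumRenyiDivergence (α : ℝ) (D : DivergenceQuantity) : Prop where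
  /-- values in `(-∞, +∞]` -/
  ne_bot : ∀ {n : Type} [Fintype n] (ρ σ : Matrix n n ℂ), IsSub ρ → ρ ≠ 0 → IsSub σ →
    D ρ σ ≠ ⊥
  /-- continuity, at `ρ ≠ 0` and `σ` of full support -/
  continuity : ∀ {n : Type} [Fintype n],
    ContinuousOn (fun p : Matrix n n ℂ × Matrix n n ℂ => D p.1 p.2)
      {p | (IsSub p.1 ∧ p.1 ≠ 0) ∧ IsSub p.2 ∧ p.2.PosDef}
  unitary_invariance : ∀ {n : Type} [Fintype n] [DecidableEq n] (U : Matrix n n ℂ),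
    U ∈ Matrix.unitaryGroup n ℂ → ∀ ρ σ : Matrix n n ℂ, IsSub ρ → ρ ≠ 0 → IsSub σ →
      D (U * ρ * U.conjTranspose) (U * σ * U.conjTranspose) = D ρ σ
  /-- `𝔻(1‖1/2) = log 2` on the one-dimensional system -/
  normalization :
    D (1 : Matrix Unit Unit ℂ) ((1 / 2 : ℂ) • (1 : Matrix Unit Unit ℂ)) =
      ((Real.log 2 : ℝ) : EReal)
  order_nonneg : ∀ {n : Type} [Fintype n] (ρ σ : Matrix n n ℂ), IsSub ρ → ρ ≠ 0 → IsSub σ →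
    (ρ - σ).PosSemidef → 0 ≤ D ρ σ
  order_nonpos : ∀ {n : Type} [Fintype n] (ρ σ : Matrix n n ℂ), IsSub ρ → ρ ≠ 0 → IsSub σ →
    (σ - ρ).PosSemidef → D ρ σ ≤ 0
  additivity : ∀ {m n : Type} [Fintype m] [Fintype n] (ρ σ : Matrix m m ℂ) (τ ω : Matrix n n ℂ),
    IsSub ρ → ρ ≠ 0 → IsSub σ → IsSub τ → τ ≠ 0 → IsSub ω →
      D (ρ ⊗ₖ τ) (σ ⊗ₖ ω) = D ρ σ + D τ ω
  general_mean : ∀ {m n : Type} [Fintype m] [Fintype n]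
    (ρ σ : Matrix m m ℂ) (τ ω : Matrix n n ℂ),
    IsSub ρ → ρ ≠ 0 → IsSub σ → IsSub τ → τ ≠ 0 → IsSub ω →
    IsSub (directSum ρ τ) → IsSub (directSum σ ω) →
      Qfun α D (directSum ρ τ) (directSum σ ω) =
        ENNReal.ofReal (ρ.trace.re / (ρ.trace.re + τ.trace.re)) * Qfun α D ρ σ +
        ENNReal.ofReal (τ.trace.re / (ρ.trace.re + τ.trace.re)) * Qfun α D τ ω
  positive_definiteness : ∀ {n : Type} [Fintype n] (ρ σ : Matrix n n ℂ), IsState ρ → IsState σ →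
    0 ≤ D ρ σ ∧ (D ρ σ = 0 ↔ ρ = σ)
  data_processing : ∀ {m n : Type} [Fintype m] [Fintype n]
    (Φ : Matrix m m ℂ →ₗ[ℂ] Matrix n n ℂ), IsChannel Φ →
    ∀ ρ σ : Matrix m m ℂ, IsSub ρ → ρ ≠ 0 → IsSub σ → D (Φ ρ) (Φ σ) ≤ D ρ σ
  /-- `Q` is jointly convex or jointly concave on pairs of states -/
  joint_convexity_or_concavity :
    (∀ {n : Type} [Fintype n] (ρ σ ρ' σ' : Matrix n n ℂ),
      IsState ρ → IsState σ → IsState ρ' → IsState σ' → ∀ s t : ℝ, 0 ≤ s → 0 ≤ t → s + t = 1 →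
        Qfun α D ((s : ℂ) • ρ + (t : ℂ) • ρ') ((s : ℂ) • σ + (t : ℂ) • σ') ≤
          ENNReal.ofReal s * Qfun α D ρ σ + ENNReal.ofReal t * Qfun α D ρ' σ') ∨
    (∀ {n : Type} [Fintype n] (ρ σ ρ' σ' : Matrix n n ℂ),
      IsState ρ → IsState σ → IsState ρ' → IsState σ' → ∀ s t : ℝ, 0 ≤ s → 0 ≤ t → s + t = 1 →
        ENNReal.ofReal s * Qfun α D ρ σ + ENNReal.ofReal t * Qfun α D ρ' σ' ≤
          Qfun α D ((s : ℂ) • ρ + (t : ℂ) • ρ') ((s : ℂ) • σ + (t : ℂ) • σ'))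
  dominance : ∀ {n : Type} [Fintype n] (ρ σ σ' : Matrix n n ℂ),
    IsSub ρ → ρ ≠ 0 → IsSub σ → IsSub σ' → (σ' - σ).PosSemidef → D ρ σ' ≤ D ρ σ

/-- `A` is `(ε, δ)`-differentially private with respect to the set `S` of states and the
neighbouring relation `nbr`: `Tr(M A(ρ)) ≤ e^ε Tr(M A(σ)) + δ` for all measurements `0 ≤ M ≤ 1`
and all neighbouring `ρ, σ ∈ S`. -/
def IsDP {m n : Type*} [Fintype m] [Fintype n] [DecidableEq n]
    (S : Set (Matrix m m ℂ)) (nbr : Matrix m m ℂ → Matrix m m ℂ → Prop)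
    (A : Matrix m m ℂ →ₗ[ℂ] Matrix n n ℂ) (ε δ : ℝ) : Prop :=
  ∀ M : Matrix n n ℂ, M.PosSemidef → (1 - M).PosSemidef →
    ∀ ρ ∈ S, ∀ σ ∈ S, nbr ρ σ →
      (M * A ρ).trace.re ≤ Real.exp ε * (M * A σ).trace.re + δ

/-- `A` is Rényi differentially private with parameter `ε` for the divergence `D` (of order `α`):
the supremum of `D(A(ρ)‖A(σ))` over neighbouring states `ρ, σ ∈ S` is at most `ε`. -/
def IsRenyiDP (D : DivergenceQuantity) {m n : Type} [Fintype m] [Fintype n]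
    (S : Set (Matrix m m ℂ)) (nbr : Matrix m m ℂ → Matrix m m ℂ → Prop)
    (A : Matrix m m ℂ →ₗ[ℂ] Matrix n n ℂ) (ε : ℝ) : Prop :=
  (⨆ (ρ ∈ S) (σ ∈ S) (_ : nbr ρ σ), D (A ρ) (A σ)) ≤ (ε : EReal)

/-- `g(δ) = -log(1 - √(1 - δ²))`. -/
def gfun (δ : ℝ) : ℝ := -Real.log (1 - Real.sqrt (1 - δ ^ 2))

end QDP

end

namespace QDP

/-! Suppose an effect `M` violates the claim, with probabilities `p > e^c q + δ`, where `c = ε +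
g(δ)/(α-1)`. Then `p > δ` and `q/p < e^{-c}`. Measuring the effect is a channel, so by data
processing `ε` bounds the divergence of the two outcome distributions. The general mean property
splits their `Q` into a weighted sum over outcomes; dropping the second outcome leaves `p ·
exp((α-1) D(p‖q))`, a divergence of scalars. On scalars, additivity and the normalization at `1/2`
force `D(1‖t) ≥ -log t`, hence `D(p‖q) ≥ -log t` whenever `q ≤ p t`. Taking logarithms, `log p +
(α-1)(-log t) ≤ (α-1) ε`. A `t` between `q/p` and `e^{-c}` contradicts this, since `g(δ) ≥ -log δ`.
-/

open scoped MatrixOrder in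
theorem exists_eq_conjTranspose_mul_self {n : Type*} [Fintype n] {M : Matrix n n ℂ}
    (hM : M.PosSemidef) : ∃ N : Matrix n n ℂ, M = N.conjTranspose * N := by
  classical
  exact CStarAlgebra.nonneg_iff_eq_star_mul_self.mp hM.nonneg

/-- Complete positivity with a one-dimensional ancilla. -/
theorem posSemidef_map_of_isChannel {m n : Type*} [Fintype m] [Fintype n]
    {Φ : Matrix m m ℂ →ₗ[ℂ] Matrix n n ℂ} (hΦ : IsChannel Φ) {X : Matrix m m ℂ}
    (hX : X.PosSemidef) : (Φ X).PosSemidef :=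
  (hΦ.completelyPositive 1 (X.submatrix Prod.fst Prod.fst) (hX.submatrix _)).submatrix
    (fun i => (i, 0))

theorem isState_map_of_isChannel {m n : Type*} [Fintype m] [Fintype n]
    {Φ : Matrix m m ℂ →ₗ[ℂ] Matrix n n ℂ} (hΦ : IsChannel Φ) {ρ : Matrix m m ℂ}
    (hρ : IsState ρ) : IsState (Φ ρ) :=
  ⟨posSemidef_map_of_isChannel hΦ hρ.1, (hΦ.tracePreserving ρ).trans hρ.2⟩

theorem IsState.isSub {n : Type*} [Fintype n] {ρ : Matrix n n ℂ} (hρ : IsState ρ) : IsSub ρ :=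
  ⟨hρ.1, by rw [hρ.2]; simp⟩

theorem IsState.ne_zero {n : Type*} [Fintype n] {ρ : Matrix n n ℂ} (hρ : IsState ρ) : ρ ≠ 0 := by
  rintro rfl
  simpa using hρ.2

/-- Relabelling the basis is a channel. -/
theorem isChannel_reindex {m n : Type*} [Fintype m] [Fintype n] (e : m ≃ n) :
    IsChannel (Matrix.reindexLinearEquiv ℂ ℂ e e : Matrix m m ℂ →ₗ[ℂ] Matrix n n ℂ) where
  completelyPositive k X hX := by
    have h : ampliation (Matrix.reindexLinearEquiv ℂ ℂ e e : Matrix m m ℂ →ₗ[ℂ] Matrix n n ℂ) k X =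
        X.submatrix (fun p => (e.symm p.1, p.2)) (fun p => (e.symm p.1, p.2)) := by
      ext p q
      simp [ampliation]
    rw [h]
    exact hX.submatrix _
  tracePreserving X := by
    simp only [Matrix.trace, LinearEquiv.coe_coe, Matrix.coe_reindexLinearEquiv,
      Matrix.diag_apply, Matrix.reindex_apply, Matrix.submatrix_apply]
    exact Equiv.sum_comp e.symm (fun i => X i i)

/-- The channel that measures the effect `M` and records the outcome. -/
def effectChannel {n : Type*} [Fintype n] [DecidableEq n] (M : Matrix n n ℂ) :
    Matrix n n ℂ →ₗ[ℂ] Matrix (Unit ⊕ Unit) (Unit ⊕ Unit) ℂ where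
  toFun X := directSum ((M * X).trace • 1) (((1 - M) * X).trace • 1)
  map_add' X Y := by
    ext i j
    rcases i with i | i <;> rcases j with j | j <;>
      simp [directSum, mul_add, Matrix.trace_add]
  map_smul' c X := by
    ext i j
    rcases i with i | i <;> rcases j with j | j <;>
      simp [directSum, Matrix.trace_smul]

theorem effectChannel_apply {n : Type*} [Fintype n] [DecidableEq n] (M X : Matrix n n ℂ) :
    effectChannel M X = directSum ((M * X).trace • 1) (((1 - M) * X).trace • 1) := rfl

/-- Tracing out the first factor against a positive operator preserves positivity. -/
theorem posSemidef_partialTrace_mul {n : Type*} [Fintype n] {M : Matrix n n ℂ}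
    (hM : M.PosSemidef) {k : ℕ} {X : Matrix (n × Fin k) (n × Fin k) ℂ} (hX : X.PosSemidef) :
    (Matrix.of fun a b : Fin k =>
      (M * Matrix.of fun i j => X (i, a) (j, b)).trace).PosSemidef := by
  classical
  obtain ⟨N, rfl⟩ := exists_eq_conjTranspose_mul_self hM
  -- With `M = N†N`, each row `N l` gives a compression of `X` by `⟨N l| ⊗ 1`, and the partial trace
  -- is their sum.
  have h : (Matrix.of fun a b : Fin k =>
      (N.conjTranspose * N * Matrix.of fun i j => X (i, a) (j, b)).trace) =
      ∑ l, (Matrix.of fun (a : Fin k) (p : n × Fin k) => if a = p.2 then N l p.1 else 0) * X *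
        (Matrix.of fun (a : Fin k) (p : n × Fin k) =>
          if a = p.2 then N l p.1 else 0).conjTranspose := by
    ext a b
    rw [Matrix.of_apply, Matrix.mul_assoc, Matrix.trace_mul_comm]
    simp only [Matrix.sum_apply, Matrix.of_apply, Matrix.trace, Matrix.diag_apply,
      Matrix.mul_apply, Matrix.conjTranspose_apply, Fintype.sum_prod_type, apply_ite star,
      star_zero, ite_mul, mul_ite, zero_mul, mul_zero, Finset.sum_ite_eq, Finset.mem_univ, if_true]
  rw [h]
  exact Matrix.posSemidef_sum _ fun l _ => hX.mul_mul_conjTranspose_same _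

theorem posSemidef_directSum {m n : Type*} [Fintype m] [Fintype n] {A : Matrix m m ℂ}
    {B : Matrix n n ℂ} (hA : A.PosSemidef) (hB : B.PosSemidef) : (directSum A B).PosSemidef := by
  classical
  obtain ⟨N, rfl⟩ := exists_eq_conjTranspose_mul_self hA
  obtain ⟨K, rfl⟩ := exists_eq_conjTranspose_mul_self hB
  convert Matrix.posSemidef_conjTranspose_mul_self (directSum N K) using 1
  simp [directSum, Matrix.fromBlocks_conjTranspose, Matrix.fromBlocks_multiply]

theorem isChannel_effectChannel {n : Type*} [Fintype n] [DecidableEq n] {M : Matrix n n ℂ}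
    (hM : M.PosSemidef) (hM' : (1 - M).PosSemidef) : IsChannel (effectChannel M) where
  completelyPositive k X hX := by
    -- The ampliated output is block diagonal in the outcome, one partial trace per outcome.
    have h := (posSemidef_directSum (posSemidef_partialTrace_mul hM hX)
      (posSemidef_partialTrace_mul hM' hX)).submatrix
        (fun p : (Unit ⊕ Unit) × Fin k => Sum.map (fun _ => p.2) (fun _ => p.2) p.1)
    convert h using 1
    ext ⟨p, a⟩ ⟨q, b⟩
    rcases p with p | p <;> rcases q with q | q <;>
      simp [ampliation, effectChannel_apply, directSum]
  tracePreserving X := by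
    simp [effectChannel_apply, directSum, Matrix.trace, sub_mul]

/-! ### The divergence on the one-dimensional system -/

/-- The operator `a` on the one-dimensional system. -/
abbrev scalarOp (a : ℝ) : Matrix Unit Unit ℂ := (a : ℂ) • 1

theorem posSemidef_scalarOp {a : ℝ} (ha : 0 ≤ a) : (scalarOp a).PosSemidef :=
  Matrix.PosSemidef.one.smul (by exact_mod_cast ha)

theorem isSub_scalarOp {a : ℝ} (h0 : 0 ≤ a) (h1 : a ≤ 1) : IsSub (scalarOp a) :=
  ⟨posSemidef_scalarOp h0, by simpa using h1⟩

theorem scalarOp_ne_zero {a : ℝ} (ha : a ≠ 0) : scalarOp a ≠ 0 := by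
  intro h
  have := congrFun (congrFun h ()) ()
  simp [ha] at this

namespace IsQuantumRenyiDivergence

variable {α : ℝ} {D : DivergenceQuantity}

/-- Data processing along the relabelling and along its inverse. This allows `Unit × Unit` to be
identified with `Unit` when additivity is applied to scalars. -/
theorem reindex_eq (hD : IsQuantumRenyiDivergence α D) {m n : Type} [Fintype m] [Fintype n]
    (e : m ≃ n) {ρ σ : Matrix m m ℂ} (hρ : IsSub ρ) (h0 : ρ ≠ 0) (hσ : IsSub σ) :
    D (Matrix.reindex e e ρ) (Matrix.reindex e e σ) = D ρ σ := by
  have htr : ∀ X : Matrix m m ℂ, (Matrix.reindex e e X).trace = X.trace :=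
    (isChannel_reindex e).tracePreserving
  have hsub : ∀ {X : Matrix m m ℂ}, IsSub X → IsSub (Matrix.reindex e e X) := fun {X} hX =>
    ⟨hX.1.submatrix e.symm, by rw [htr]; exact hX.2⟩
  refine le_antisymm (hD.data_processing _ (isChannel_reindex e) ρ σ hρ h0 hσ) ?_
  have h := hD.data_processing _ (isChannel_reindex e.symm) (Matrix.reindex e e ρ)
    (Matrix.reindex e e σ) (hsub hρ) (fun h => h0 ?_) (hsub hσ)
  · simpa using h
  · exact (Matrix.reindex e e).injective (h.trans (by simp))

theorem scalarOp_mul (hD : IsQuantumRenyiDivergence α D) {a b c d : ℝ} (ha : 0 < a) (ha1 : a ≤ 1)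
    (hb : 0 ≤ b) (hb1 : b ≤ 1) (hc : 0 < c) (hc1 : c ≤ 1) (hd : 0 ≤ d) (hd1 : d ≤ 1) :
    D (scalarOp (a * c)) (scalarOp (b * d)) =
      D (scalarOp a) (scalarOp b) + D (scalarOp c) (scalarOp d) := by
  have key : ∀ x y : ℝ, scalarOp (x * y) =
      Matrix.reindex (Equiv.prodUnique Unit Unit) (Equiv.prodUnique Unit Unit)
        (scalarOp x ⊗ₖ scalarOp y) := by
    intro x y
    ext i j
    simp
  have hsub : ∀ x y : ℝ, 0 ≤ x → x ≤ 1 → 0 ≤ y → y ≤ 1 → IsSub (scalarOp x ⊗ₖ scalarOp y) :=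
    fun x y hx hx1 hy hy1 =>
      ⟨(posSemidef_scalarOp hx).kronecker (posSemidef_scalarOp hy), by
        rw [Matrix.trace_kronecker]
        simpa using mul_le_one₀ hx1 hy hy1⟩
  rw [← hD.additivity _ _ _ _ (isSub_scalarOp ha.le ha1) (scalarOp_ne_zero ha.ne')
    (isSub_scalarOp hb hb1) (isSub_scalarOp hc.le hc1) (scalarOp_ne_zero hc.ne')
    (isSub_scalarOp hd hd1), key, key]
  refine hD.reindex_eq _ (hsub _ _ ha.le ha1 hc.le hc1) (fun h => ?_) (hsub _ _ hb hb1 hd hd1)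
  apply scalarOp_ne_zero (mul_pos ha hc).ne'
  rw [key, h]
  simp

theorem scalarOp_self (hD : IsQuantumRenyiDivergence α D) {a : ℝ} (ha : 0 < a) (ha1 : a ≤ 1) :
    D (scalarOp a) (scalarOp a) = 0 := by
  have hs := isSub_scalarOp ha.le ha1
  have h0 := scalarOp_ne_zero ha.ne'
  have hz : (scalarOp a - scalarOp a).PosSemidef := by
    rw [sub_self]
    exact Matrix.PosSemidef.zero
  exact le_antisymm (hD.order_nonpos _ _ hs h0 hs hz) (hD.order_nonneg _ _ hs h0 hs hz)

theorem scalarOp_pow (hD : IsQuantumRenyiDivergence α D) {x : ℝ} (hx : 0 ≤ x) (hx1 : x ≤ 1)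
    (k : ℕ) : D (scalarOp 1) (scalarOp (x ^ k)) = k • D (scalarOp 1) (scalarOp x) := by
  induction k with
  | zero => simpa using hD.scalarOp_self one_pos le_rfl
  | succ k ih =>
    rw [pow_succ, succ_nsmul, ← ih, ← hD.scalarOp_mul one_pos le_rfl (pow_nonneg hx k)
      (pow_le_one₀ hx hx1) one_pos le_rfl hx hx1, one_mul]

theorem scalarOp_anti (hD : IsQuantumRenyiDivergence α D) {a x y : ℝ} (ha : 0 < a) (ha1 : a ≤ 1)
    (hx : 0 ≤ x) (hxy : x ≤ y) (hy1 : y ≤ 1) :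
    D (scalarOp a) (scalarOp y) ≤ D (scalarOp a) (scalarOp x) := by
  refine hD.dominance _ _ _ (isSub_scalarOp ha.le ha1) (scalarOp_ne_zero ha.ne')
    (isSub_scalarOp hx (hxy.trans hy1)) (isSub_scalarOp (hx.trans hxy) hy1) ?_
  rw [← sub_smul, ← Complex.ofReal_sub]
  exact posSemidef_scalarOp (sub_nonneg.mpr hxy)

/-- On the one-dimensional system, `𝔻(1‖t) ≥ -log t`. -/
theorem neg_log_le_scalarOp (hD : IsQuantumRenyiDivergence α D) {t : ℝ} (ht : 0 < t)
    (ht1 : t ≤ 1) : ((-Real.log t : ℝ) : EReal) ≤ D (scalarOp 1) (scalarOp t) := by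
  have hhalf : D (scalarOp 1) (scalarOp (1 / 2)) = ((Real.log 2 : ℝ) : EReal) := by
    simpa [scalarOp] using hD.normalization
  have hlog2 : 0 < Real.log 2 := Real.log_pos one_lt_two
  have hL : 0 ≤ -Real.log t := neg_nonneg.mpr (Real.log_nonpos ht.le ht1)
  -- Compare `t ^ k` with `(1/2) ^ j`, where the divergence is known to be `j log 2`.
  have hpow : ∀ k j : ℕ, j * Real.log 2 ≤ k * -Real.log t →
      ((j * Real.log 2 : ℝ) : EReal) ≤ k • D (scalarOp 1) (scalarOp t) := by
    intro k j hkj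
    have hle : t ^ k ≤ (1 / 2 : ℝ) ^ j := by
      rw [← Real.log_le_log_iff (by positivity) (by positivity), Real.log_pow, Real.log_pow,
        one_div, Real.log_inv]
      linarith
    have h := hD.scalarOp_anti one_pos le_rfl (pow_nonneg ht.le k) hle
      (pow_le_one₀ (by norm_num) (by norm_num))
    rw [hD.scalarOp_pow ht.le ht1, hD.scalarOp_pow (by norm_num) (by norm_num), hhalf,
      ← EReal.coe_nsmul, nsmul_eq_mul] at h
    exact h
  induction hx : D (scalarOp 1) (scalarOp t) using EReal.rec with
  | bot =>
    exact absurd hx (hD.ne_bot _ _ (isSub_scalarOp zero_le_one le_rfl)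
      (scalarOp_ne_zero one_ne_zero) (isSub_scalarOp ht.le ht1))
  | top => exact le_top
  | coe x =>
    rw [EReal.coe_le_coe_iff]
    by_contra! hlt
    -- Rounding `k(-log t)` down to a multiple of `log 2` loses less than `log 2`; this `k` makes
    -- the assumed gap exceed that loss.
    obtain ⟨k, hk⟩ := exists_nat_gt (Real.log 2 / (-Real.log t - x))
    rw [div_lt_iff₀ (by linarith)] at hk
    have hfl := Nat.floor_le (show 0 ≤ k * -Real.log t / Real.log 2 by positivity)
    have hfl' := Nat.lt_floor_add_one (k * -Real.log t / Real.log 2)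
    rw [le_div_iff₀ hlog2] at hfl
    rw [div_lt_iff₀ hlog2] at hfl'
    have h := hpow k _ hfl
    rw [hx, ← EReal.coe_nsmul, EReal.coe_le_coe_iff, nsmul_eq_mul] at h
    linarith

/-- A divergence between states bounds the likelihood ratio of every effect whose probability in
the first state is strictly between `0` and `1`. -/
theorem log_add_le_of_effect (hD : IsQuantumRenyiDivergence α D) (hα : 1 < α) {n : Type}
    [Fintype n] [DecidableEq n] {ρ σ M : Matrix n n ℂ} (hρ : IsState ρ) (hσ : IsState σ)
    (hM : M.PosSemidef) (hM' : (1 - M).PosSemidef) {p q t ε : ℝ} (hp : 0 < p) (hp1 : p < 1)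
    (hq : 0 ≤ q) (hMρ : (M * ρ).trace = p) (hMσ : (M * σ).trace = q) (ht : 0 < t) (ht1 : t ≤ 1)
    (hqt : q ≤ p * t) (hε : D ρ σ ≤ (ε : EReal)) :
    Real.log p + (α - 1) * -Real.log t ≤ (α - 1) * ε := by
  have hpt : p * t ≤ 1 := mul_le_one₀ hp1.le ht.le ht1
  have hq1 : q ≤ 1 := hqt.trans hpt
  have hα0 : (0 : ℝ) ≤ α - 1 := by linarith
  have himage : ∀ {X : Matrix n n ℂ} {x : ℝ}, IsState X → (M * X).trace = x →
      effectChannel M X = directSum (scalarOp x) (scalarOp (1 - x)) := by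
    intro X x hX hx
    rw [effectChannel_apply, sub_mul, Matrix.trace_sub, one_mul, hX.2, hx]
    simp [scalarOp]
  have hch := isChannel_effectChannel hM hM'
  have hdp := hD.data_processing _ hch ρ σ hρ.isSub hρ.ne_zero hσ.isSub
  have hsρ := (isState_map_of_isChannel hch hρ).isSub
  have hsσ := (isState_map_of_isChannel hch hσ).isSub
  rw [himage hρ hMρ, himage hσ hMσ] at hdp
  rw [himage hρ hMρ] at hsρ
  rw [himage hσ hMσ] at hsσ
  have hmean := hD.general_mean _ _ _ _ (isSub_scalarOp hp.le hp1.le) (scalarOp_ne_zero hp.ne')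
    (isSub_scalarOp hq hq1) (isSub_scalarOp (sub_nonneg.mpr hp1.le) (by linarith))
    (scalarOp_ne_zero (sub_pos.mpr hp1).ne') (isSub_scalarOp (sub_nonneg.mpr hq1) (by linarith))
    hsρ hsσ
  -- `D(p‖q) ≥ D(p‖pt) = D(p‖p) + D(1‖t)`, and `D(p‖p) = 0`.
  have hratio : ((-Real.log t : ℝ) : EReal) ≤ D (scalarOp p) (scalarOp q) := by
    refine (hD.neg_log_le_scalarOp ht ht1).trans ?_
    have h := hD.scalarOp_mul hp hp1.le hp.le hp1.le one_pos le_rfl ht.le ht1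
    rw [hD.scalarOp_self hp hp1.le, zero_add, mul_one] at h
    rw [← h]
    exact hD.scalarOp_anti hp hp1.le hq hqt hpt
  have hmono : ∀ {x y : EReal}, x ≤ y →
      EReal.exp (((α - 1 : ℝ) : EReal) * x) ≤ EReal.exp (((α - 1 : ℝ) : EReal) * y) :=
    fun hxy => EReal.exp_monotone (mul_le_mul_of_nonneg_left hxy (by exact_mod_cast hα0))
  have hlow : ENNReal.ofReal p * EReal.exp (((α - 1 : ℝ) : EReal) * ((-Real.log t : ℝ) : EReal)) ≤
      EReal.exp (((α - 1 : ℝ) : EReal) * (ε : EReal)) := by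
    refine le_trans ?_ ((hmono hdp).trans (hmono hε))
    refine le_trans ?_ hmean.ge
    refine le_trans ?_ le_self_add
    have hw : (scalarOp p).trace.re / ((scalarOp p).trace.re + (scalarOp (1 - p)).trace.re) = p := by
      simp
    rw [hw]
    exact mul_le_mul_right (hmono hratio) _
  rw [← EReal.coe_mul, ← EReal.coe_mul, EReal.exp_coe, EReal.exp_coe,
    ← ENNReal.ofReal_mul hp.le, ENNReal.ofReal_le_ofReal_iff (Real.exp_pos _).le] at hlow
  have h := Real.log_le_log (by positivity) hlow
  rwa [Real.log_mul hp.ne' (Real.exp_pos _).ne', Real.log_exp, Real.log_exp] at h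

end IsQuantumRenyiDivergence

/-- Since `(1 - δ)² ≤ 1 - δ²` on `[0, 1]`. The argument needs only `-log δ`, so `g` enters through
this bound and its sign. -/
theorem neg_log_le_gfun {δ : ℝ} (h0 : 0 < δ) (h1 : δ ≤ 1) : -Real.log δ ≤ gfun δ := by
  refine neg_le_neg (Real.log_le_log (sub_pos.mpr ?_) ?_)
  · rw [Real.sqrt_lt' one_pos]
    nlinarith
  · have : 1 - δ ≤ Real.sqrt (1 - δ ^ 2) := Real.le_sqrt_of_sq_le (by nlinarith)
    linarith

theorem trace_mul_nonneg {n : Type*} [Fintype n] {M X : Matrix n n ℂ} (hM : M.PosSemidef)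
    (hX : X.PosSemidef) : 0 ≤ (M * X).trace := by
  classical
  obtain ⟨N, rfl⟩ := exists_eq_conjTranspose_mul_self hM
  rw [Matrix.mul_assoc, Matrix.trace_mul_comm]
  exact (hX.mul_mul_conjTranspose_same N).trace_nonneg

theorem trace_mul_eq_re {n : Type*} [Fintype n] {M X : Matrix n n ℂ} (hM : M.PosSemidef)
    (hX : X.PosSemidef) : (M * X).trace = ((M * X).trace.re : ℂ) :=
  Complex.ext rfl (by simpa using (Complex.le_def.mp (trace_mul_nonneg hM hX)).2.symm)

end QDP

theorem mainTheorem12 {m n : Type} [Fintype m] [Fintype n] [DecidableEq n]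
    (S : Set (Matrix m m ℂ)) (hS : ∀ ρ ∈ S, QDP.IsState ρ)
    (nbr : Matrix m m ℂ → Matrix m m ℂ → Prop)
    (A : Matrix m m ℂ →ₗ[ℂ] Matrix n n ℂ) (hA : QDP.IsChannel A)
    (α : ℝ) (hα : 1 < α)
    (D : QDP.DivergenceQuantity) (hD : QDP.IsQuantumRenyiDivergence α D)
    (ε δ : ℝ) (hδ0 : 0 < δ) (hδ1 : δ ≤ 1)
    (hRenyi : QDP.IsRenyiDP D S nbr A ε) :
    QDP.IsDP S nbr A (ε + QDP.gfun δ / (α - 1)) δ := by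
  intro M hM hM' ρ hρ σ hσ hnbr
  have hε : D (A ρ) (A σ) ≤ (ε : EReal) :=
    
    (le_iSup₂_of_le ρ hρ <| le_iSup₂_of_le σ hσ <|
      le_iSup (fun _ : nbr ρ σ => D (A ρ) (A σ)) hnbr).trans hRenyi
  have hAρ := QDP.isState_map_of_isChannel hA (hS ρ hρ)
  have hAσ := QDP.isState_map_of_isChannel hA (hS σ hσ)
  -- Gives `c ≥ 0`, so that `t ≤ 1` below and the scalar `t` is subnormalized.
  have hε0 : 0 ≤ ε := by
    exact_mod_cast (hD.positive_definiteness _ _ hAρ hAσ).1.trans hε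
  have hα0 : 0 < α - 1 := sub_pos.mpr hα
  have hg := QDP.neg_log_le_gfun hδ0 hδ1
  have hg0 : 0 ≤ QDP.gfun δ := (neg_nonneg.mpr (Real.log_nonpos hδ0.le hδ1)).trans hg
  have hc0 : 0 ≤ ε + QDP.gfun δ / (α - 1) := by positivity
  set c := ε + QDP.gfun δ / (α - 1) with hc
  have hMρ := QDP.trace_mul_eq_re hM hAρ.1
  have hMσ := QDP.trace_mul_eq_re hM hAσ.1
  have hq : 0 ≤ (M * A σ).trace.re := (Complex.le_def.mp (QDP.trace_mul_nonneg hM hAσ.1)).1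
  have hp1 : (M * A ρ).trace.re ≤ 1 := by
    have h := (Complex.le_def.mp (QDP.trace_mul_nonneg hM' hAρ.1)).1
    rw [sub_mul, Matrix.trace_sub, one_mul, hAρ.2] at h
    simpa using h
  set p := (M * A ρ).trace.re
  set q := (M * A σ).trace.re
  by_contra! hlt
  have hqe : 0 ≤ Real.exp c * q := by positivity
  have hδp : δ < p := by linarith
  have hp : 0 < p := hδ0.trans hδp
  have hδ1' : δ < 1 := hδp.trans_le hp1
  have hqp : q / p < Real.exp (-c) := by
    rw [Real.exp_neg, div_lt_iff₀ hp, inv_mul_eq_div, lt_div_iff₀ (Real.exp_pos c)]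
    linarith
  -- Choosing `t` strictly above `q / p` keeps it positive even if `q = 0`.
  obtain ⟨t, hqt, htc⟩ := exists_between hqp
  have ht : 0 < t := (div_nonneg hq hp.le).trans_lt hqt
  have ht1 : t ≤ 1 := htc.le.trans (Real.exp_le_one_iff.mpr (neg_nonpos.mpr hc0))
  -- The general mean property needs both outcomes nonzero, which fails if `p = 1`. Scaling `M` by
  -- `δ / p` makes the first probability exactly `δ < 1` and preserves the ratio `q / p`.
  have hs0 : 0 ≤ δ / p := by positivity
  have hs1 : δ / p ≤ 1 := (div_le_one hp).mpr hδp.le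
  have hMs : (((δ / p : ℝ) : ℂ) • M).PosSemidef := hM.smul (by exact_mod_cast hs0)
  have hMs' : (1 - ((δ / p : ℝ) : ℂ) • M).PosSemidef := by
    have h1 : ((((1 - δ / p : ℝ)) : ℂ) • (1 : Matrix n n ℂ)).PosSemidef :=
      Matrix.PosSemidef.one.smul (by exact_mod_cast sub_nonneg.mpr hs1)
    have h2 : (((δ / p : ℝ) : ℂ) • (1 - M)).PosSemidef := hM'.smul (by exact_mod_cast hs0)
    convert h1.add h2 using 1
    rw [Complex.ofReal_sub, Complex.ofReal_one, sub_smul, smul_sub, one_smul]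
    abel
  have key := hD.log_add_le_of_effect hα hAρ hAσ hMs hMs' hδ0 hδ1' (q := δ / p * q) (by positivity)
    (by
      rw [Matrix.smul_mul, Matrix.trace_smul, hMρ, smul_eq_mul, ← Complex.ofReal_mul,
        div_mul_cancel₀ _ hp.ne'])
    (by rw [Matrix.smul_mul, Matrix.trace_smul, hMσ, smul_eq_mul, ← Complex.ofReal_mul])
    ht ht1
    (by
      rw [div_mul_eq_mul_div, mul_div_assoc]
      exact mul_le_mul_of_nonneg_left hqt.le hδ0.le)
    hε
  have hlt' : c < -Real.log t := by
    have := Real.log_lt_log ht htc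
    rw [Real.log_exp] at this
    linarith
  have hcα : (α - 1) * c = (α - 1) * ε + QDP.gfun δ := by
    rw [hc]
    field_simp
  have := mul_lt_mul_of_pos_left hlt' hα0
  linarith
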